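/- Let $X$ be a (real or complex) Banach space and let $B_{X^*}=\{f\in X^* : \|f\|\le 1\}$ be its closed dual unit ball, endowed with the weak$^*$ topology. Then there are a compact Hausdorff totally disconnected space $L$ and a continuous surjection $p\colon L\to B_{X^*}$ such that 1. $L$ and $B_{X^*}$ have the same weight, where the weight of a topological space is the least cardinality of a base of its topology; and 2. $L$ has no uncountable well-ordered chain of clopen sets: every family of clopen subsets of $L$ that is well-ordered by inclusion is countable. -/

import Mathlib

open Set TopologicalSpace

universe u

/-- The weight of a topological space: the least cardinality of a base of its topology. -/
noncomputable def topologicalWeight (T : Type u) [TopologicalSpace T] : Cardinal.{u} :=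
  sInf {κ : Cardinal.{u} | ∃ B : Set (Set T), IsTopologicalBasis B ∧ Cardinal.mk B = κ}

/-- The closed unit ball of the dual of a normed space, as a subset of the dual endowed with the
weak* topology (so that its coercion to a type carries the weak* topology). -/
def weakStarDualBall (𝕜 : Type) (X : Type u) [RCLike 𝕜] [NormedAddCommGroup X]
    [NormedSpace 𝕜 X] : Set (WeakDual 𝕜 X) :=
  {f : WeakDual 𝕜 X | ‖WeakDual.toStrongDual f‖ ≤ 1}

/-- A well-ordered chain in a partial order: a subset that is totally ordered and in which every
nonempty subset has a least element. -/
def IsWellOrderedChain {P : Type u} [PartialOrder P] (C : Set P) : Prop :=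
  IsChain (· ≤ ·) C ∧ ∀ S : Set P, S ⊆ C → S.Nonempty → ∃ a : P, IsLeast S a

/-!
The dual ball `Z` is affinely homeomorphic to a compact convex set `K ⊆ ℝ^I` through the maps
`f ↦ Re (f x)`, where the vectors `x` are indexed by a set `I` of pairs of members of a base of `Z`
of least cardinality (`exists_separating_of_isTopologicalBasis`). The space `L` is the sign cover of
`K`: its points are the points `f` of `K` together with a choice of signs for all the numbers
`f i - q`, with `q` rational, both signs being allowed when the number is zero. The signs determine
`f`, so `L` is a closed subspace of a Cantor cube, of weight at most `max ℵ₀ #I`; and `L` maps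
onto `K`.

The point is that, over a given `f`, the signs are chosen independently of each other. Let `A i` be
an uncountable strictly increasing family of clopen sets. Each `A i` depends on a finite set `F i`
of signs. If some sign occurs in uncountably many `F i`, fix it: this replaces `K` by its
intersection with a half-space and makes those `F i` smaller. So, by induction on the size, the
`F i` may be taken pairwise disjoint, of size `n` (`exists_uncountable_pairwiseDisjoint`). Collect
the functionals that occur in `F i` into an affine map `y i : K → ℝⁿ`. Then `A i` and its complement
correspond to closed sets `P` and `Q` with `P ∪ Q = ℝⁿ`, and for `i < j` independence of the signs
gives that no `f` has `y i f ∈ P` and `y j f ∈ Q`. By compactness this persists with an error that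
depends on `i` but, by passing through the successor of `i`, not on `j`. By the pigeonhole
principle there are such `i < j` with the same `P`, `Q` and error, for which `y i` and `y j` have
almost the same image and almost the same value at a base point.

Convexity now gives a contradiction (`forall_notMem_or_forall_notMem_of_separated`). Consider the
orbits of the relation that consists of the pairs `(y i f, y j f)`, where every step may be
perturbed a little, in particular by a slight contraction towards the base point. Such orbits lead from every
point to the base point and from the base point to every point, but none of them leads from `P` to
`Q`. Hence `A i` is empty or `A j` is everything, which cannot be in the middle of the family.
-/

/-! ### Drifting towards a centre -/

theorem dist_lineMap_lineMap_le_two_mul {V : Type*} [NormedAddCommGroup V] [NormedSpace ℝ V]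
    {a a' b b' : V} {r s δ M : ℝ} (hs : 0 ≤ s) (hsr : s ≤ r) (hr : r ≤ 1)
    (ha : dist a' a ≤ δ) (hb : dist b' b ≤ δ) (haM : ‖a‖ ≤ M) (hbM : ‖b‖ ≤ M)
    (hrs : (r - s) * (2 * M) ≤ δ) :
    dist (AffineMap.lineMap a' b' s) (AffineMap.lineMap a b r) ≤ 2 * δ := by
  rw [dist_eq_norm] at *
  have e : AffineMap.lineMap a' b' s - AffineMap.lineMap a b r =
      ((1 - s) • (a' - a) + s • (b' - b)) + (r - s) • (a - b) := by
    simp only [AffineMap.lineMap_apply_module]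
    module
  rw [e]
  have h1 : ‖(1 - s) • (a' - a)‖ ≤ (1 - s) * δ := by
    rw [norm_smul, Real.norm_of_nonneg (by linarith)]
    exact mul_le_mul_of_nonneg_left ha (by linarith)
  have h2 : ‖s • (b' - b)‖ ≤ s * δ := by
    rw [norm_smul, Real.norm_of_nonneg hs]
    exact mul_le_mul_of_nonneg_left hb hs
  have h3 : ‖(r - s) • (a - b)‖ ≤ (r - s) * (2 * M) := by
    rw [norm_smul, Real.norm_of_nonneg (by linarith)]
    exact mul_le_mul_of_nonneg_left ((norm_sub_le _ _).trans (by linarith)) (by linarith)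
  have h4 := norm_add_le ((1 - s) • (a' - a) + s • (b' - b)) ((r - s) • (a - b))
  have h5 := norm_add_le ((1 - s) • (a' - a)) (s • (b' - b))
  linarith

/-- Let `y` and `y'` be bounded affine maps on a convex set `K` whose images are `δ`-close, also at
a base point `f₀`, and let `P ∪ Q` be everything. If `y' f ∈ Q` forces `y f` to be far from `P`,
then one of `y' ⁻¹' Q` and `y ⁻¹' P` misses `K`. Indeed `f ↦ y f` and `f ↦ y' f` define a relation on
`V` whose approximate orbits, shrunk a little towards the base point at every step, join every point
to the base point and back; the separation does not let such an orbit cross from one side to the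
other. -/
theorem forall_notMem_or_forall_notMem_of_separated {E V : Type*} [AddCommGroup E] [Module ℝ E]
    [NormedAddCommGroup V] [NormedSpace ℝ V] {K : Set E} (hK : Convex ℝ K) {y y' : E →ᵃ[ℝ] V}
    {M : ℝ} (hM : ∀ f ∈ K, ‖y f‖ ≤ M) (hM' : ∀ f ∈ K, ‖y' f‖ ≤ M) {P Q : Set V}
    (hPQ : ∀ v, v ∈ P ∨ v ∈ Q) (hP : IsClosed P) {δ : ℝ} (hδ : 0 < δ)
    (hsep : ∀ f ∈ K, y' f ∈ Q → ∀ p ∈ P, 3 * δ ≤ dist (y f) p) {f₀ : E} (hf₀ : f₀ ∈ K)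
    (h₀ : dist (y' f₀) (y f₀) ≤ δ) (h₁ : ∀ f ∈ K, ∃ f' ∈ K, dist (y' f') (y f) ≤ δ)
    (h₂ : ∀ f ∈ K, ∃ f' ∈ K, dist (y f') (y' f) ≤ δ) :
    (∀ f ∈ K, y' f ∉ Q) ∨ ∀ f ∈ K, y f ∉ P := by
  have hM0 : 0 ≤ M := (norm_nonneg _).trans (hM _ hf₀)
  -- the ratio `t` is so close to `1` that one shrinking step moves points by at most `δ`
  set t : ℝ := 2 * M / (2 * M + δ) with ht
  have hden : 0 < 2 * M + δ := by linarith
  have ht0 : 0 ≤ t := by positivity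
  have ht1 : t < 1 := by rw [ht, div_lt_one hden]; linarith
  have htM : (1 - t) * (2 * M) ≤ δ := by
    have : 1 - t = δ / (2 * M + δ) := by rw [ht]; field_simp; ring
    rw [this, div_mul_eq_mul_div, div_le_iff₀ hden]
    nlinarith
  have hpow0 : ∀ k, 0 ≤ t ^ k := fun k => pow_nonneg ht0 k
  have hpow1 : ∀ k, t ^ k ≤ 1 := fun k => pow_le_one₀ ht0 ht1.le
  have hstep : ∀ k, (t ^ k - t ^ (k + 1)) * (2 * M) ≤ δ := fun k => by
    have h : (t ^ k - t ^ (k + 1)) * (2 * M) = t ^ k * ((1 - t) * (2 * M)) := by ring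
    rw [h]
    have h' : 0 ≤ (1 - t) * (2 * M) := mul_nonneg (by linarith) (by linarith)
    nlinarith [hpow0 k, hpow1 k]
  have hlim : Filter.Tendsto (fun k => t ^ k * (2 * M)) Filter.atTop (nhds 0) := by
    simpa using (tendsto_pow_atTop_nhds_zero_of_lt_one ht0 ht1).mul_const (2 * M)
  have hmem : ∀ f ∈ K, ∀ k, AffineMap.lineMap f₀ f (t ^ k) ∈ K := fun f hf k =>
    hK.lineMap_mem hf₀ hf ⟨hpow0 k, hpow1 k⟩
  have hclose : ∀ z : E →ᵃ[ℝ] V, (∀ f ∈ K, ‖z f‖ ≤ M) → ∀ f ∈ K, ∀ k,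
      dist (z (AffineMap.lineMap f₀ f (t ^ k))) (z f₀) ≤ t ^ k * (2 * M) := by
    intro z hz f hf k
    rw [AffineMap.apply_lineMap, dist_lineMap_left, Real.norm_of_nonneg (hpow0 k)]
    refine mul_le_mul_of_nonneg_left ?_ (hpow0 k)
    rw [dist_eq_norm]
    exact (norm_sub_le _ _).trans (by linarith [hz f hf, hz f₀ hf₀])
  have hmono : ∀ k, t ^ (k + 1) ≤ t ^ k := fun k => pow_le_pow_of_le_one ht0 ht1.le (Nat.le_succ k)
  choose! a haK ha using h₁
  choose! b hbK hb using h₂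
  by_cases hc : y' f₀ ∈ P
  · -- a backward orbit starting in `Q` stays in `Q` but converges to the base point, in `P`
    left
    intro f hf hfQ
    have hsK : ∀ k, a^[k] f ∈ K := fun k => by
      induction k with
      | zero => exact hf
      | succ k ih => rw [Function.iterate_succ_apply']; exact haK _ ih
    have hQ : ∀ k, y' (AffineMap.lineMap f₀ (a^[k] f) (t ^ k)) ∈ Q := fun k => by
      induction k with
      | zero => simpa using hfQ
      | succ k ih =>
        refine (hPQ _).resolve_left fun hp => ?_
        have h1 := hsep _ (hmem _ (hsK k) k) ih _ hp
        have h2 : dist (y' (AffineMap.lineMap f₀ (a^[k + 1] f) (t ^ (k + 1))))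
            (y (AffineMap.lineMap f₀ (a^[k] f) (t ^ k))) ≤ 2 * δ := by
          rw [AffineMap.apply_lineMap, AffineMap.apply_lineMap, Function.iterate_succ_apply']
          exact dist_lineMap_lineMap_le_two_mul (hpow0 _) (hmono k) (hpow1 k) h₀ (ha _ (hsK k))
            (hM _ hf₀) (hM _ (hsK k)) (hstep k)
        rw [dist_comm] at h2
        linarith
    obtain ⟨k, hk⟩ := (hlim.eventually (gt_mem_nhds hδ)).exists
    have h1 := hsep _ (hmem _ (hsK k) k) (hQ k) _ hc
    have h2 := hclose y hM _ (hsK k) k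
    have h3 := dist_triangle (y (AffineMap.lineMap f₀ (a^[k] f) (t ^ k))) (y f₀) (y' f₀)
    rw [dist_comm (y f₀)] at h3
    linarith
  · -- a forward orbit starting in `P` stays in `P` and converges to the base point, not in `P`
    right
    intro f hf hfP
    refine hc ?_
    have hsK : ∀ k, b^[k] f ∈ K := fun k => by
      induction k with
      | zero => exact hf
      | succ k ih => rw [Function.iterate_succ_apply']; exact hbK _ ih
    have hfar : ∀ g ∈ K, ∀ p ∈ P, dist (y g) p ≤ 2 * δ → y' g ∈ P := fun g hg p hp hgp =>
      (hPQ _).resolve_right fun hq => by linarith [hsep g hg hq p hp]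
    have hPk : ∀ k, y' (AffineMap.lineMap f₀ (b^[k] f) (t ^ k)) ∈ P := fun k => by
      induction k with
      | zero =>
        simp only [Function.iterate_zero, id_eq, pow_zero, AffineMap.lineMap_apply_one]
        exact hfar f hf _ hfP (by rw [dist_self]; linarith)
      | succ k ih =>
        refine hfar _ (hmem _ (hsK (k + 1)) (k + 1)) _ ih ?_
        rw [AffineMap.apply_lineMap, AffineMap.apply_lineMap, Function.iterate_succ_apply']
        exact dist_lineMap_lineMap_le_two_mul (hpow0 _) (hmono k) (hpow1 k)
          (by rwa [dist_comm]) (hb _ (hsK k)) (hM' _ hf₀) (hM' _ (hsK k)) (hstep k)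
    refine hP.mem_of_tendsto (b := Filter.atTop) (tendsto_iff_dist_tendsto_zero.2 ?_)
      (Filter.Eventually.of_forall hPk)
    exact squeeze_zero (fun _ => dist_nonneg) (fun k => hclose y' hM' _ (hsK k) k) hlim

/-! ### Uncountable families -/

theorem exists_uncountable_preimage_singleton {ι κ : Type*} [Uncountable ι] [Countable κ]
    (c : ι → κ) : ∃ k, ¬ (c ⁻¹' {k}).Countable := by
  by_contra! h
  refine not_countable_univ (α := ι) ((countable_iUnion h).mono fun i _ => ?_)
  exact mem_iUnion.2 ⟨c i, rfl⟩

/-- A disjoint refinement in the spirit of the Δ-system lemma: if no point lies in uncountably many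
members of an uncountable family of finite sets, then the family has an uncountable pairwise
disjoint subfamily. -/
theorem exists_uncountable_pairwiseDisjoint {ι T : Type*} [Uncountable ι] (F : ι → Finset T)
    (hF : ∀ t, {i | t ∈ F i}.Countable) :
    ∃ J : Set ι, ¬ J.Countable ∧ J.PairwiseDisjoint F := by
  obtain ⟨J, hJ⟩ := zorn_subset {J : Set ι | J.PairwiseDisjoint F} fun c hc hchain =>
    ⟨⋃₀ c, (pairwiseDisjoint_sUnion hchain.directedOn).2 fun s hs => hc hs,
      fun s hs => subset_sUnion_of_mem hs⟩
  refine ⟨J, fun hJc => ?_, hJ.prop⟩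
  have hbad : (J ∪ ⋃ j ∈ J, ⋃ t ∈ F j, {i | t ∈ F i}).Countable :=
    hJc.union (hJc.biUnion fun j _ => (F j).countable_toSet.biUnion fun t _ => hF t)
  obtain ⟨i, hi⟩ : ∃ i, i ∉ J ∪ ⋃ j ∈ J, ⋃ t ∈ F j, {i | t ∈ F i} := by
    by_contra! h
    exact not_countable_univ (hbad.mono fun i _ => h i)
  simp only [mem_union, mem_iUnion, mem_ofPred_eq, not_or, not_exists] at hi
  refine hi.1 (hJ.le_of_ge (y := insert i J) ?_ (subset_insert i J) (mem_insert i J))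
  refine PairwiseDisjoint.insert hJ.prop fun j hj _ => ?_
  exact Finset.disjoint_left.2 fun t hti htj => hi.2 j hj t htj hti

theorem uncountable_not_isMax {ι : Type*} [LinearOrder ι] [Uncountable ι] :
    Uncountable {i : ι // ¬ IsMax i} := by
  by_contra h
  rw [not_uncountable_iff] at h
  have hmax : {i : ι | IsMax i}.Countable :=
    Set.Subsingleton.countable fun i hi j hj =>
      (le_total i j).elim (fun hij => hij.antisymm (hi hij)) fun hji => (hj hji).antisymm hji
  exact not_countable_univ ((hmax.union h.to_set).mono fun i _ => em (IsMax i))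

/-! ### Sign patterns -/

/-- The Boolean vector `b` is a sign pattern of the real vector `v`: it is `true` only at
nonnegative and `false` only at nonpositive coordinates. At a zero coordinate both values are allowed,
and independently so for different coordinates. -/
def IsSignPattern {T : Type*} (v : T → ℝ) (b : T → Bool) : Prop :=
  ∀ t, (b t = true → 0 ≤ v t) ∧ (b t = false → v t ≤ 0)

theorem exists_isSignPattern {T : Type*} (v : T → ℝ) : ∃ b, IsSignPattern v b := by
  classical
  refine ⟨fun t => decide (0 ≤ v t), fun t => ⟨fun h => of_decide_eq_true h, fun h => ?_⟩⟩
  exact (not_le.1 (of_decide_eq_false h)).le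

theorem IsSignPattern.update {T : Type*} [DecidableEq T] {v : T → ℝ} {b : T → Bool}
    (h : IsSignPattern v b) {t : T} {x : Bool} (hx : (x = true → 0 ≤ v t) ∧ (x = false → v t ≤ 0)) :
    IsSignPattern v (Function.update b t x) := by
  intro t'
  by_cases ht : t' = t
  · subst ht; simpa using hx
  · simpa [ht] using h t'

theorem isClosed_setOf_isSignPattern {T Z : Type*} [TopologicalSpace Z] {v : Z → T → ℝ}
    {b : Z → T → Bool} (hv : ∀ t, Continuous fun z => v z t) (hb : ∀ t, Continuous fun z => b z t) :
    IsClosed {z | IsSignPattern (v z) (b z)} := by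
  have : {z | IsSignPattern (v z) (b z)} = ⋂ t,
      (({z | b z t = true}ᶜ ∪ {z | 0 ≤ v z t}) ∩ ({z | b z t = false}ᶜ ∪ {z | v z t ≤ 0})) := by
    ext z
    simp only [IsSignPattern, mem_ofPred_eq, mem_iInter, mem_inter_iff, mem_union, mem_compl_iff,
      imp_iff_not_or]
  rw [this]
  refine isClosed_iInter fun t => IsClosed.inter (IsClosed.union ?_ ?_) (IsClosed.union ?_ ?_)
  · exact ((isOpen_discrete {true}).preimage (hb t)).isClosed_compl
  · exact isClosed_le continuous_const (hv t)
  · exact ((isOpen_discrete {false}).preimage (hb t)).isClosed_compl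
  · exact isClosed_le (hv t) continuous_const

/-- The set of real vectors that have a sign pattern in `s`. -/
def signRegion {T : Type*} (s : Set (T → Bool)) : Set (T → ℝ) :=
  {v | ∃ b ∈ s, IsSignPattern v b}

theorem isClosed_signRegion {T : Type*} [Finite T] (s : Set (T → Bool)) :
    IsClosed (signRegion s) := by
  have : signRegion s = ⋃ b ∈ s, {v | IsSignPattern v b} := by
    ext v; simp [signRegion]
  rw [this]
  exact s.toFinite.isClosed_biUnion fun b _ =>
    isClosed_setOf_isSignPattern (fun t => continuous_apply t) fun t => continuous_const

theorem mem_signRegion_or_mem_signRegion_compl {T : Type*} (s : Set (T → Bool)) (v : T → ℝ) :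
    v ∈ signRegion s ∨ v ∈ signRegion sᶜ := by
  obtain ⟨b, hb⟩ := exists_isSignPattern v
  exact (em (b ∈ s)).imp (fun h => ⟨b, h, hb⟩) fun h => ⟨b, h, hb⟩

/-! ### Grid cells -/

/-- The cell containing `v` of the cubical grid of mesh `1 / (m + 1)`. -/
noncomputable def gridCell {n : ℕ} (m : ℕ) (v : Fin n → ℝ) : Fin n → ℤ :=
  fun i => ⌊v i * (m + 1)⌋

theorem dist_le_of_gridCell_eq {n m : ℕ} {v w : Fin n → ℝ} (h : gridCell m v = gridCell m w) :
    dist v w ≤ 1 / (m + 1) := by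
  have hm : (0 : ℝ) < m + 1 := by positivity
  refine (dist_pi_le_iff (by positivity)).2 fun i => ?_
  have h1 := Int.abs_sub_lt_one_of_floor_eq_floor (congrFun h i)
  rw [← sub_mul, abs_mul, abs_of_pos hm] at h1
  rw [Real.dist_eq, le_div_iff₀ hm]
  exact h1.le

theorem finite_gridCell_image {n m : ℕ} {M : ℝ} {s : Set (Fin n → ℝ)} (hs : ∀ v ∈ s, ‖v‖ ≤ M) :
    (gridCell m '' s).Finite := by
  have hm : (0 : ℝ) ≤ m + 1 := by positivity
  refine (finite_Icc (fun _ => ⌊-M * (m + 1)⌋) (fun _ => ⌊M * (m + 1)⌋)).subset ?_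
  rintro _ ⟨v, hv, rfl⟩
  have h i := abs_le.1 ((norm_le_pi_norm v i).trans (hs v hv))
  exact ⟨fun i => Int.floor_le_floor (mul_le_mul_of_nonneg_right (h i).1 hm),
    fun i => Int.floor_le_floor (mul_le_mul_of_nonneg_right (h i).2 hm)⟩

/-! ### Chains of sets of sign patterns -/

/-- A family `S` of sets of Boolean vectors, the `i`-th of which depends only on the coordinates in
the finite set `F i`, that is strictly increasing as far as the sign patterns of the vectors
`(g t f)ₜ` with `f ∈ K` can tell. -/
structure IsSignChain {ι T E : Type*} [LinearOrder ι] [AddCommGroup E] [Module ℝ E] (K : Set E)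
    (g : T → E →ᵃ[ℝ] ℝ) (F : ι → Finset T) (S : ι → Set (T → Bool)) : Prop where
  dependsOn : ∀ i b b', (∀ t ∈ F i, b t = b' t) → b ∈ S i → b' ∈ S i
  mono : ∀ i j, i < j → ∀ f ∈ K, ∀ b, IsSignPattern (g · f) b → b ∈ S i → b ∈ S j
  strict : ∀ i j, i < j → ∃ f ∈ K, ∃ b, IsSignPattern (g · f) b ∧ b ∈ S j ∧ b ∉ S i

namespace IsSignChain

variable {ι T E : Type*} [LinearOrder ι] [AddCommGroup E] [Module ℝ E] {K : Set E}
  {g : T → E →ᵃ[ℝ] ℝ} {F : ι → Finset T} {S : ι → Set (T → Bool)}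

theorem restrict (h : IsSignChain K g F S) (p : ι → Prop) :
    IsSignChain K g (fun i : Subtype p => F i) (fun i => S i) :=
  ⟨fun i => h.dependsOn i, fun i j hij => h.mono i j hij, fun i j hij => h.strict i j hij⟩

/-- Coordinates in disjoint supports can be chosen independently. -/
theorem exists_mem_and_notMem {n : ℕ} {i j : ι} (h : IsSignChain K g F S)
    (hF : Disjoint (F i) (F j)) {a b : Fin n → T} (ha : range a = F i)
    (hb : range b = F j) (hbi : Function.Injective b) {f : E}
    (hi : (fun k => g (a k) f) ∈ signRegion ((fun c k => c (a k)) '' S i))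
    (hj : (fun k => g (b k) f) ∈ signRegion ((fun c k => c (b k)) '' S j)ᶜ) :
    ∃ c, IsSignPattern (g · f) c ∧ c ∈ S i ∧ c ∉ S j := by
  classical
  obtain ⟨_, ⟨c, hc, rfl⟩, hcs⟩ := hi
  obtain ⟨d, hd, hds⟩ := hj
  obtain ⟨e, he⟩ := exists_isSignPattern (g · f)
  have hbF : ∀ k, b k ∉ F i := fun k hk =>
    Finset.disjoint_left.1 hF hk (Finset.mem_coe.1 (hb ▸ mem_range_self k))
  refine ⟨fun t => if t ∈ F i then c t else Function.extend b d e t, fun t => ?_, ?_, fun hS => ?_⟩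
  · by_cases ht : t ∈ F i
    · obtain ⟨k, rfl⟩ : t ∈ range a := ha ▸ ht
      simpa [ht] using hcs k
    · by_cases ht' : t ∈ range b
      · obtain ⟨k, rfl⟩ := ht'
        simpa [ht, hbi.extend_apply] using hds k
      · have := Function.extend_apply' (f := b) d e t ht'
        simpa [ht, this] using he t
  · exact h.dependsOn i c _ (fun t ht => by simp [ht]) hc
  · refine hd ⟨_, hS, ?_⟩
    ext k
    simp [hbF k, hbi.extend_apply]

/-- The heart of the matter: if the supports are pairwise disjoint, then the chain is countable. All
the relevant data attached to an index is, up to a controlled error, one of countably many, so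
two indices far enough apart have the same data, which contradicts
`forall_notMem_or_forall_notMem_of_separated`. -/
theorem countable_of_disjoint [WellFoundedLT ι] [TopologicalSpace E] (h : IsSignChain K g F S)
    (hKc : IsCompact K) (hK : Convex ℝ K) (hg : ∀ t, Continuous (g t))
    (hF : Pairwise fun i j => Disjoint (F i) (F j)) {n : ℕ} (hn : ∀ i, (F i).card = n) :
    Countable ι := by
  by_contra hι
  rw [not_countable_iff] at hι
  let _ := SuccOrder.ofLinearWellFoundedLT ι
  let a : ι → Fin n → T := fun i k => (Finset.equivFinOfCardEq (hn i)).symm k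
  have ha : ∀ i, range (a i) = F i := fun i => by
    ext t
    refine ⟨?_, fun ht => ⟨Finset.equivFinOfCardEq (hn i) ⟨t, ht⟩, by simp [a]⟩⟩
    rintro ⟨k, rfl⟩
    exact Subtype.prop _
  have hai : ∀ i, Function.Injective (a i) := fun i =>
    Subtype.val_injective.comp (Equiv.injective _)
  let y : ι → E →ᵃ[ℝ] (Fin n → ℝ) := fun i => AffineMap.pi fun k => g (a i k)
  have hy : ∀ i, Continuous (y i) := fun i => continuous_pi fun k => hg (a i k)
  let s : ι → Set (Fin n → Bool) := fun i => (fun c k => c (a i k)) '' S i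
  have hcross : ∀ i j, i < j → ∀ f ∈ K, y j f ∈ signRegion (s j)ᶜ → y i f ∉ signRegion (s i) := by
    intro i j hij f hf hj hi
    obtain ⟨c, hc, hci, hcj⟩ := h.exists_mem_and_notMem (hF hij.ne) (ha i) (ha j) (hai j) hi hj
    exact hcj (h.mono i j hij f hf c hc hci)
  have hne : ∀ i j, i < j → (∃ f ∈ K, y j f ∈ signRegion (s j)) ∧
      ∃ f ∈ K, y i f ∈ signRegion (s i)ᶜ := by
    intro i j hij
    obtain ⟨f, hf, b, hb, hbj, hbi⟩ := h.strict i j hij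
    refine ⟨⟨f, hf, _, ⟨b, hbj, rfl⟩, fun k => hb _⟩, f, hf, fun k => b (a i k), ?_, fun k => hb _⟩
    rintro ⟨b', hb', hbb'⟩
    refine hbi (h.dependsOn i b' b (fun t ht => ?_) hb')
    obtain ⟨k, rfl⟩ : t ∈ range (a i) := ha i ▸ ht
    exact congrFun hbb' k
  -- where `y j` may have a pattern outside `s j`, `y i` stays away from the region of `s i`, by a
  -- distance independent of `j`: it suffices to treat the successor of `i`, by `hcross`
  have hsep : ∀ i, ∃ m : ℕ, ¬ IsMax i → ∀ j, Order.succ i ≤ j → ∀ f ∈ K,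
      y j f ∈ signRegion (s j)ᶜ → ∀ p ∈ signRegion (s i),
        3 * (1 / ((m : ℝ) + 1)) ≤ dist (y i f) p := by
    intro i
    by_cases hi : IsMax i
    · exact ⟨0, fun h => absurd hi h⟩
    have hi' := Order.lt_succ_of_not_isMax hi
    have hcomp : IsCompact (y i '' (K ∩ y (Order.succ i) ⁻¹' signRegion (s (Order.succ i))ᶜ)) :=
      (hKc.inter_right ((isClosed_signRegion _).preimage (hy _))).image (hy i)
    have hdisj : Disjoint (y i '' (K ∩ y (Order.succ i) ⁻¹' signRegion (s (Order.succ i))ᶜ))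
        (signRegion (s i)) := by
      rw [disjoint_left]
      rintro _ ⟨f, ⟨hf, hfs⟩, rfl⟩
      exact hcross _ _ hi' f hf hfs
    obtain ⟨ε, hε, hεd⟩ := hdisj.exists_thickenings hcomp (isClosed_signRegion _)
    obtain ⟨m, hm⟩ := exists_nat_one_div_lt (show 0 < ε / 3 by positivity)
    refine ⟨m, fun _ j hij f hf hfj p hp => ?_⟩
    have hfs : y (Order.succ i) f ∈ signRegion (s (Order.succ i))ᶜ := by
      rcases hij.eq_or_lt with rfl | hlt
      · exact hfj
      · exact (mem_signRegion_or_mem_signRegion_compl _ _).resolve_left (hcross _ _ hlt f hf hfj)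
    by_contra! hlt
    refine disjoint_left.1 hεd (Metric.mem_thickening_iff.2 ⟨y i f, ⟨f, ⟨hf, hfs⟩, rfl⟩, ?_⟩)
      (Metric.self_subset_thickening hε _ hp)
    rw [dist_comm]
    linarith
  choose m hm using hsep
  obtain ⟨f₀, hf₀⟩ : K.Nonempty := by
    obtain ⟨i, j, hij⟩ := exists_pair_ne ι
    rcases hij.lt_or_gt with hij | hij
    exacts [(h.strict _ _ hij).imp fun f hf => hf.1, (h.strict _ _ hij).imp fun f hf => hf.1]
  have hbdd : ∀ i, ∃ M, ∀ f ∈ K, ‖y i f‖ ≤ M := fun i =>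
    hKc.exists_bound_of_continuousOn (hy i).continuousOn
  choose M hM using hbdd
  have hfin : ∀ i, (gridCell (m i) '' (y i '' K)).Finite := fun i =>
    finite_gridCell_image (M := M i) (by rintro _ ⟨f, hf, rfl⟩; exact hM i f hf)
  have := uncountable_not_isMax (ι := ι)
  obtain ⟨d, hd⟩ := exists_uncountable_preimage_singleton
    fun i : {i : ι // ¬ IsMax i} => (s i, m i, (hfin i).toFinset, gridCell (m i) (y i f₀))
  obtain ⟨J, hJd, hJ⟩ := Set.Infinite.exists_subset_card_eq (fun hf => hd hf.countable) 4
  have hdata : ∀ k, (s (J.orderEmbOfFin hJ k), m (J.orderEmbOfFin hJ k),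
      (hfin (J.orderEmbOfFin hJ k)).toFinset,
      gridCell (m (J.orderEmbOfFin hJ k)) (y (J.orderEmbOfFin hJ k) f₀)) = d :=
    fun k => hJd (J.orderEmbOfFin_mem hJ k)
  have hlt : ∀ k l : Fin 4, k < l → (J.orderEmbOfFin hJ k : ι) < J.orderEmbOfFin hJ l :=
    fun k l hkl => (J.orderEmbOfFin hJ).lt_iff_lt.2 hkl
  -- the second and the last of four indices with the same data
  have hij : Order.succ (J.orderEmbOfFin hJ 1 : ι) ≤ J.orderEmbOfFin hJ 3 :=
    Order.succ_le_of_lt (hlt 1 3 (by decide))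
  have hi := (hne _ _ (hlt 0 1 (by decide))).1
  obtain ⟨l, hl⟩ := not_isMax_iff.1 (J.orderEmbOfFin hJ 3).2
  have hj := (hne _ _ hl).2
  have hi_max := (J.orderEmbOfFin hJ 1).2
  have hdd := (hdata 1).trans (hdata 3).symm
  generalize (J.orderEmbOfFin hJ 1 : ι) = i at *
  generalize (J.orderEmbOfFin hJ 3 : ι) = j at *
  simp only [Prod.mk.injEq] at hdd
  obtain ⟨hs, hmm, hcells, hcell₀⟩ := hdd
  rw [Finite.toFinset_inj, ← hmm] at hcells
  rw [← hmm] at hcell₀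
  have hclose : ∀ k l, gridCell (m i) '' (y k '' K) = gridCell (m i) '' (y l '' K) →
      ∀ f ∈ K, ∃ f' ∈ K, dist (y l f') (y k f) ≤ 1 / ((m i : ℝ) + 1) := by
    intro k l hkl f hf
    have : gridCell (m i) (y k f) ∈ gridCell (m i) '' (y l '' K) :=
      hkl ▸ mem_image_of_mem _ (mem_image_of_mem _ hf)
    obtain ⟨_, ⟨f', hf', rfl⟩, he⟩ := this
    exact ⟨f', hf', dist_le_of_gridCell_eq he⟩
  rcases forall_notMem_or_forall_notMem_of_separated hK (y := y i) (y' := y j)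
    (M := max (M i) (M j))
    (fun f hf => (hM i f hf).trans (le_max_left _ _))
    (fun f hf => (hM j f hf).trans (le_max_right _ _))
    (mem_signRegion_or_mem_signRegion_compl (s i)) (isClosed_signRegion _)
    (δ := 1 / ((m i : ℝ) + 1)) (by positivity)
    (fun f hf hfQ => hm i hi_max j hij f hf (hs ▸ hfQ)) hf₀ (dist_le_of_gridCell_eq hcell₀.symm)
    (hclose i j hcells) (hclose j i hcells.symm) with hQ | hP
  · obtain ⟨f, hf, hfQ⟩ := hj
    exact hQ f hf (hs ▸ hfQ)
  · obtain ⟨f, hf, hfP⟩ := hi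
    exact hP f hf hfP

/-- The inductive step: fixing the sign of a coordinate `t` removes `t` from all supports, at the
expense of cutting `K` by a half-space; the chain remains strict on an uncountable set
of indices. -/
theorem exists_restrict_erase [DecidableEq T] [WellFoundedLT ι] [Uncountable ι]
    (h : IsSignChain K g F S) (t : T) :
    ∃ (x : Bool) (p : ι → Prop), Uncountable (Subtype p) ∧
      IsSignChain (K ∩ {f | (x = true → 0 ≤ g t f) ∧ (x = false → g t f ≤ 0)}) g
        (fun i : Subtype p => (F i).erase t) (fun i => {b | Function.update b t x ∈ S i}) := by
  let _ := SuccOrder.ofLinearWellFoundedLT ι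
  have := uncountable_not_isMax (ι := ι)
  have hstrict := fun i : {i : ι // ¬ IsMax i} =>
    h.strict i (Order.succ i) (Order.lt_succ_of_not_isMax i.2)
  choose f hfK b hb hbS hbS' using hstrict
  obtain ⟨x, hx⟩ := exists_uncountable_preimage_singleton fun i => b i t
  refine ⟨x, fun i => ∃ hi : ¬ IsMax i, b ⟨i, hi⟩ t = x, ?_, ?_, ?_, ?_⟩
  · rw [← not_countable_iff]
    intro hc
    refine hx ?_
    have hinj : Function.Injective fun i : ((fun i => b i t) ⁻¹' {x}) =>
        (⟨i.1.1, i.1.2, i.2⟩ : {i // ∃ hi : ¬ IsMax i, b ⟨i, hi⟩ t = x}) := fun i j hij => by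
      have hval := congrArg Subtype.val hij
      exact Subtype.ext (Subtype.ext hval)
    exact hinj.countable
  · intro i c c' hcc' hc
    refine h.dependsOn i _ _ (fun t' ht' => ?_) hc
    by_cases htt : t' = t
    · subst htt; simp
    · simpa [htt] using hcc' t' (Finset.mem_erase.2 ⟨htt, ht'⟩)
  · intro i j hij f hf c hc hci
    exact h.mono i j hij f hf.1 _ (hc.update hf.2) hci
  · rintro ⟨i, hi, hix⟩ j hij
    have hupd : Function.update (b ⟨i, hi⟩) t x = b ⟨i, hi⟩ := by
      rw [Function.update_eq_self_iff, hix]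
    refine ⟨f ⟨i, hi⟩, ⟨hfK _, by subst hix; exact hb ⟨i, hi⟩ t⟩, b ⟨i, hi⟩, hb _, ?_, ?_⟩
    · change Function.update _ t x ∈ S j
      rw [hupd]
      rcases (Order.succ_le_of_lt (show i < j from hij)).eq_or_lt with he | hlt
      · exact he ▸ hbS ⟨i, hi⟩
      · exact h.mono _ _ hlt _ (hfK _) _ (hb _) (hbS ⟨i, hi⟩)
    · change Function.update _ t x ∉ S i
      rw [hupd]
      exact hbS' ⟨i, hi⟩

theorem countable_of_card_eq {T E : Type*} [AddCommGroup E] [Module ℝ E] [TopologicalSpace E]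
    {g : T → E →ᵃ[ℝ] ℝ} (hg : ∀ t, Continuous (g t)) (n : ℕ) :
    ∀ {ι : Type u} [LinearOrder ι] [WellFoundedLT ι] {K : Set E} {F : ι → Finset T}
      {S : ι → Set (T → Bool)}, IsSignChain K g F S → IsCompact K → Convex ℝ K →
      (∀ i, (F i).card = n) → Countable ι := by
  classical
  induction n with
  | zero =>
    intro ι _ _ K F S h hKc hK hn
    refine h.countable_of_disjoint hKc hK hg (fun i j _ => ?_) hn
    simp [Finset.card_eq_zero.1 (hn i)]
  | succ n ih =>
    intro ι _ _ K F S h hKc hK hn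
    by_contra hι
    rw [not_countable_iff] at hι
    by_cases hF : ∀ t, {i | t ∈ F i}.Countable
    · obtain ⟨J, hJ, hJF⟩ := exists_uncountable_pairwiseDisjoint F hF
      exact hJ ((h.restrict (· ∈ J)).countable_of_disjoint hKc hK hg
        (fun i j hij => hJF i.2 j.2 (Subtype.coe_ne_coe.2 hij)) fun i => hn i).to_set
    · push Not at hF
      obtain ⟨t, ht⟩ := hF
      have : Uncountable {i // t ∈ F i} := not_countable_iff.1 fun hc => ht hc.to_set
      obtain ⟨x, p, hp, hx⟩ := (h.restrict (t ∈ F ·)).exists_restrict_erase t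
      have hclosed : IsClosed {f | (x = true → 0 ≤ g t f) ∧ (x = false → g t f ≤ 0)} := by
        cases x
        · simpa using isClosed_le (hg t) continuous_const
        · simpa using isClosed_le continuous_const (hg t)
      have hconvex : Convex ℝ {f | (x = true → 0 ≤ g t f) ∧ (x = false → g t f ≤ 0)} := by
        cases x
        · simpa [preimage, Iic] using (convex_Iic (𝕜 := ℝ) (0 : ℝ)).affine_preimage (g t)
        · simpa [preimage, Ici] using (convex_Ici (𝕜 := ℝ) (0 : ℝ)).affine_preimage (g t)
      refine not_countable_iff.2 hp (ih hx (hKc.inter_right hclosed) (hK.inter hconvex) fun i => ?_)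
      rw [Finset.card_erase_of_mem i.1.2, hn, Nat.add_sub_cancel]

/-- Over a compact convex set, well-ordered chains of sets of sign patterns are countable. -/
theorem countable {ι : Type u} {T E : Type*} [LinearOrder ι] [WellFoundedLT ι] [AddCommGroup E]
    [Module ℝ E] [TopologicalSpace E] {K : Set E} {g : T → E →ᵃ[ℝ] ℝ} {F : ι → Finset T}
    {S : ι → Set (T → Bool)} (h : IsSignChain K g F S) (hKc : IsCompact K) (hK : Convex ℝ K)
    (hg : ∀ t, Continuous (g t)) : Countable ι := by
  by_contra hι
  rw [not_countable_iff] at hι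
  obtain ⟨n, hn⟩ := exists_uncountable_preimage_singleton fun i => (F i).card
  exact hn (countable_of_card_eq hg n (h.restrict fun i => (F i).card = n) hKc hK
    fun i => i.2).to_set

end IsSignChain

/-! ### Weight -/

theorem topologicalWeight_le {Z : Type u} [TopologicalSpace Z] {B : Set (Set Z)}
    (hB : IsTopologicalBasis B) : topologicalWeight Z ≤ Cardinal.mk B :=
  csInf_le' ⟨B, hB, rfl⟩

theorem exists_isTopologicalBasis_mk_eq_topologicalWeight (Z : Type u) [TopologicalSpace Z] :
    ∃ B : Set (Set Z), IsTopologicalBasis B ∧ Cardinal.mk B = topologicalWeight Z :=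
  csInf_mem (s := {κ : Cardinal.{u} | ∃ B : Set (Set Z), IsTopologicalBasis B ∧ Cardinal.mk B = κ})
    ⟨_, _, isTopologicalBasis_opens, rfl⟩

theorem mk_finset_le_max (A : Type u) :
    Cardinal.mk (Finset A) ≤ max Cardinal.aleph0 (Cardinal.mk A) := by
  rcases finite_or_infinite A with h | h
  · exact le_max_of_le_left Cardinal.mk_le_aleph0
  · exact le_max_of_le_right (Cardinal.mk_finset_of_infinite A).le

theorem aleph0_le_topologicalWeight (Z : Type u) [TopologicalSpace Z] [T0Space Z] [Infinite Z] :
    Cardinal.aleph0 ≤ topologicalWeight Z := by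
  obtain ⟨B, hB, hBw⟩ := exists_isTopologicalBasis_mk_eq_topologicalWeight Z
  rw [← hBw, Cardinal.aleph0_le_mk_iff]
  by_contra hfin
  rw [not_infinite_iff_finite] at hfin
  refine (Finite.of_injective (fun z : Z => {U : B | z ∈ U.1}) fun z w hzw => ?_).not_infinite ‹_›
  refine (hB.inseparable_iff.2 fun U hU => ?_).eq
  exact Set.ext_iff.1 hzw ⟨U, hU⟩

/-- Continuous surjections of compact spaces onto Hausdorff spaces do not raise the weight. -/
theorem topologicalWeight_le_of_surjective {L Z : Type u} [TopologicalSpace L] [CompactSpace L]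
    [TopologicalSpace Z] [T2Space Z] {p : L → Z} (hp : Continuous p) (hps : Function.Surjective p) :
    topologicalWeight Z ≤ max Cardinal.aleph0 (topologicalWeight L) := by
  obtain ⟨B, hB, hBw⟩ := exists_isTopologicalBasis_mk_eq_topologicalWeight L
  let W : Finset B → Set Z := fun u => (p '' (⋃ U ∈ u, U.1)ᶜ)ᶜ
  have hW : IsTopologicalBasis (range W) := by
    refine isTopologicalBasis_of_isOpen_of_nhds ?_ fun z V hz hV => ?_
    · rintro _ ⟨u, rfl⟩
      refine (hp.isClosedMap _ (IsOpen.isClosed_compl ?_)).isOpen_compl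
      exact isOpen_biUnion fun U _ => hB.isOpen U.2
    · have hfib : IsCompact (p ⁻¹' {z}) := (isClosed_singleton.preimage hp).isCompact
      have hcov : ∀ x : L, ∃ U : B, x ∈ p ⁻¹' {z} → x ∈ U.1 ∧ U.1 ⊆ p ⁻¹' V := by
        intro x
        by_cases hx : x ∈ p ⁻¹' {z}
        · obtain ⟨U, hU, hxU, hUV⟩ := hB.exists_subset_of_mem_open
            (show p x ∈ V from (show p x = z from hx).symm ▸ hz) (hV.preimage hp)
          exact ⟨⟨U, hU⟩, fun _ => ⟨hxU, hUV⟩⟩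
        · obtain ⟨U, hU, -⟩ := hB.exists_subset_of_mem_open (mem_univ x) isOpen_univ
          exact ⟨⟨U, hU⟩, fun h => absurd h hx⟩
      choose U hU using hcov
      classical
      obtain ⟨s, hs, hsc⟩ := hfib.elim_nhds_subcover (fun x => (U x).1)
        fun x hx => (hB.isOpen (U x).2).mem_nhds (hU x hx).1
      refine ⟨W (s.image U), ⟨_, rfl⟩, ?_, ?_⟩
      · rintro ⟨x, hx, rfl⟩
        refine hx ?_
        simpa using hsc (show x ∈ p ⁻¹' {p x} from rfl)
      · intro w hw
        obtain ⟨x, rfl⟩ := hps w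
        have hx : x ∈ ⋃ U' ∈ s.image U, U'.1 := by
          by_contra hx
          exact hw ⟨x, hx, rfl⟩
        simp only [Finset.mem_image, mem_iUnion] at hx
        obtain ⟨_, ⟨x', hx', rfl⟩, hxU⟩ := hx
        exact (hU x' (hs x' hx')).2 hxU
  rw [← hBw]
  exact (topologicalWeight_le hW).trans (Cardinal.mk_range_le.trans (mk_finset_le_max B))

/-- A separating family of continuous functions can be thinned out to one indexed by pairs of
members of a given base. -/
theorem exists_separating_of_isTopologicalBasis {Z X : Type*} [TopologicalSpace Z] [Nonempty X]
    {B : Set (Set Z)} (hB : IsTopologicalBasis B) {φ : X → Z → ℝ} (hφ : ∀ x, Continuous (φ x))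
    (hsep : ∀ z w, z ≠ w → ∃ x, φ x z ≠ φ x w) :
    ∃ ξ : B × B → X, ∀ z w, z ≠ w → ∃ i, φ (ξ i) z ≠ φ (ξ i) w := by
  have : ∀ i : B × B, ∃ x, (∃ x', ∀ z ∈ i.1.1, ∀ w ∈ i.2.1, φ x' z ≠ φ x' w) →
      ∀ z ∈ i.1.1, ∀ w ∈ i.2.1, φ x z ≠ φ x w := fun i => by
    by_cases h : ∃ x', ∀ z ∈ i.1.1, ∀ w ∈ i.2.1, φ x' z ≠ φ x' w
    · exact h.imp fun x hx _ => hx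
    · exact ⟨Classical.arbitrary X, fun h' => absurd h' h⟩
  choose ξ hξ using this
  refine ⟨ξ, fun z w hzw => ?_⟩
  obtain ⟨x, hx⟩ := hsep z w hzw
  obtain ⟨U', V', hU', hV', hzU', hwV', hd⟩ := t2_separation hx
  obtain ⟨U, hU, hzU, hUU'⟩ := hB.exists_subset_of_mem_open
    (show z ∈ φ x ⁻¹' U' from hzU') (hU'.preimage (hφ x))
  obtain ⟨V, hV, hwV, hVV'⟩ := hB.exists_subset_of_mem_open
    (show w ∈ φ x ⁻¹' V' from hwV') (hV'.preimage (hφ x))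
  exact ⟨(⟨U, hU⟩, ⟨V, hV⟩), hξ (⟨U, hU⟩, ⟨V, hV⟩)
    ⟨x, fun a ha b hb => hd.ne_of_mem (hUU' ha) (hVV' hb)⟩ z hzU w hwV⟩

/-! ### Spaces embedded in a Cantor cube -/

section CantorCube

variable {Z T : Type*} [TopologicalSpace Z] {β : Z → T → Bool}

theorem exists_finset_forall_eq_imp_mem (hβ : Topology.IsInducing β) {U : Set Z} (hU : IsOpen U)
    {z : Z} (hz : z ∈ U) : ∃ F : Finset T, ∀ w, (∀ t ∈ F, β w t = β z t) → w ∈ U := by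
  obtain ⟨V, hV, rfl⟩ := hβ.isOpen_iff.1 hU
  obtain ⟨F, u, hu, huV⟩ := isOpen_pi_iff.1 hV _ hz
  exact ⟨F, fun w hw => huV fun t ht => hw t ht ▸ (hu t ht).2⟩

theorem isOpen_setOf_forall_eq (hβ : Topology.IsInducing β) (F : Finset T) (b : T → Bool) :
    IsOpen {z | ∀ t ∈ F, β z t = b t} := by
  have : {z | ∀ t ∈ F, β z t = b t} = ⋂ t ∈ F, (β · t) ⁻¹' {b t} := by ext; simp
  rw [this]
  exact isOpen_biInter_finset fun t _ =>
    (isOpen_discrete _).preimage ((continuous_apply t).comp hβ.continuous)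

/-- A clopen set depends on finitely many coordinates only. -/
theorem exists_finset_forall_mem_of_isClopen [CompactSpace Z] (hβ : Topology.IsInducing β)
    {A : Set Z} (hA : IsClopen A) : ∃ F : Finset T, ∀ z ∈ A, ∀ w, (∀ t ∈ F, β w t = β z t) →
      w ∈ A := by
  classical
  choose! F hF using fun z (hz : z ∈ A) => exists_finset_forall_eq_imp_mem hβ hA.isOpen hz
  obtain ⟨s, hs, hsA⟩ := hA.isClosed.isCompact.elim_nhds_subcover
    (fun z => {w | ∀ t ∈ F z, β w t = β z t}) fun z _ =>
      (isOpen_setOf_forall_eq hβ (F z) (β z)).mem_nhds fun _ _ => rfl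
  refine ⟨s.biUnion F, fun z hz w hw => ?_⟩
  obtain ⟨x, hx, hzx⟩ := mem_iUnion₂.1 (hsA hz)
  exact hF x (hs x hx) w fun t ht =>
    (hw t (Finset.mem_biUnion.2 ⟨x, hx, ht⟩)).trans (hzx t ht)

theorem topologicalWeight_le_of_isInducing {Z T : Type u} [TopologicalSpace Z] {β : Z → T → Bool}
    (hβ : Topology.IsInducing β) :
    topologicalWeight Z ≤ max Cardinal.aleph0 (Cardinal.mk (T × Bool)) := by
  classical
  have hB : IsTopologicalBasis
      (range fun u : Finset (T × Bool) => {z | ∀ p ∈ u, β z p.1 = p.2}) := by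
    refine isTopologicalBasis_of_isOpen_of_nhds ?_ fun z U hz hU => ?_
    · rintro _ ⟨u, rfl⟩
      have : {z | ∀ p ∈ u, β z p.1 = p.2} = ⋂ p ∈ u, (β · p.1) ⁻¹' {p.2} := by ext; simp
      simp only [this]
      exact isOpen_biInter_finset fun p _ =>
        (isOpen_discrete _).preimage ((continuous_apply p.1).comp hβ.continuous)
    · obtain ⟨F, hF⟩ := exists_finset_forall_eq_imp_mem hβ hU hz
      refine ⟨_, ⟨F.image fun t => (t, β z t), rfl⟩, by simp, fun w hw => hF w fun t ht => ?_⟩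
      exact hw (t, β z t) (Finset.mem_image_of_mem _ ht)
  exact (topologicalWeight_le hB).trans (Cardinal.mk_range_le.trans (mk_finset_le_max _))

end CantorCube

/-! ### The sign cover of a compact convex set -/

/-- The affine functional `f ↦ f i - q` on `ℝ^I`, for `t = (i, q)`. -/
noncomputable def rationalShift {I : Type*} (t : I × ℚ) : (I → ℝ) →ᵃ[ℝ] ℝ :=
  (LinearMap.proj t.1 : (I → ℝ) →ₗ[ℝ] ℝ).toAffineMap - AffineMap.const ℝ (I → ℝ) (t.2 : ℝ)

theorem rationalShift_apply {I : Type*} (t : I × ℚ) (f : I → ℝ) :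
    rationalShift t f = f t.1 - t.2 := by
  simp [rationalShift]

theorem continuous_rationalShift {I : Type*} (t : I × ℚ) :
    Continuous (rationalShift t : (I → ℝ) →ᵃ[ℝ] ℝ) := by
  simp only [funext (rationalShift_apply t)]
  fun_prop

/-- The points of `K ⊆ ℝ^I`, each doubled along every hyperplane `f i = q` with rational `q` that it
lies on: a point of the sign cover is a point `f` of `K` with a choice of signs for all the numbers
`f i - q`. -/
def signCover {I : Type*} (K : Set (I → ℝ)) : Set ((I → ℝ) × (I × ℚ → Bool)) :=
  {z | z.1 ∈ K ∧ IsSignPattern (rationalShift · z.1) z.2}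

section SignCover

variable {I : Type u} {K : Set (I → ℝ)}

theorem isCompact_signCover (hK : IsCompact K) : IsCompact (signCover K) := by
  have : signCover K = K ×ˢ univ ∩ {z | IsSignPattern (rationalShift · z.1) z.2} := by
    ext z; simp [signCover]
  rw [this]
  refine (hK.prod isCompact_univ).inter_right
    (isClosed_setOf_isSignPattern (fun t => ?_) fun t => ?_)
  · exact (continuous_rationalShift t).comp continuous_fst
  · exact (continuous_apply t).comp continuous_snd

/-- The signs determine the point. -/
theorem injective_signCover_snd : Function.Injective fun z : signCover K => z.1.2 := by
  rintro ⟨⟨f, b⟩, hf⟩ ⟨⟨f', b'⟩, hf'⟩ (rfl : b = b')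
  have key : ∀ f f' : I → ℝ, IsSignPattern (rationalShift · f) b →
      IsSignPattern (rationalShift · f') b → ∀ i, f i ≤ f' i := by
    intro f f' h h' i
    by_contra! hlt
    obtain ⟨q, hq, hq'⟩ := exists_rat_btwn hlt
    have h1 := h' (i, q)
    have h2 := h (i, q)
    simp only [rationalShift_apply] at h1 h2
    cases hb : b (i, q)
    · linarith [h2.2 hb]
    · linarith [h1.1 hb]
  have : f = f' := funext fun i => (key f f' hf.2 hf'.2 i).antisymm (key f' f hf'.2 hf.2 i)
  subst this
  rfl

theorem isClosedEmbedding_signCover_snd (hK : IsCompact K) :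
    Topology.IsClosedEmbedding fun z : signCover K => z.1.2 := by
  have := isCompact_iff_compactSpace.1 (isCompact_signCover hK)
  exact (continuous_snd.comp continuous_subtype_val).isClosedEmbedding injective_signCover_snd

theorem totallyDisconnectedSpace_signCover : TotallyDisconnectedSpace (signCover K) :=
  ⟨isTotallyDisconnected_of_image (continuous_snd.comp continuous_subtype_val).continuousOn
    injective_signCover_snd (isTotallyDisconnected_of_totallyDisconnectedSpace _)⟩

theorem surjective_signCover_fst :
    Function.Surjective fun z : signCover K => (⟨z.1.1, z.2.1⟩ : K) := by
  rintro ⟨f, hf⟩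
  obtain ⟨b, hb⟩ := exists_isSignPattern (rationalShift · f)
  exact ⟨⟨(f, b), hf, hb⟩, rfl⟩

theorem topologicalWeight_signCover_le (hK : IsCompact K) :
    topologicalWeight (signCover K) ≤ max Cardinal.aleph0 (Cardinal.mk I) := by
  refine (topologicalWeight_le_of_isInducing
    (isClosedEmbedding_signCover_snd hK).isInducing).trans ?_
  refine max_le (le_max_left _ _) ?_
  have : Cardinal.mk ((I × ℚ) × Bool) = Cardinal.mk I * Cardinal.mk (ULift.{u} (ℚ × Bool)) := by
    rw [Cardinal.mul_def]
    exact Cardinal.mk_congr ((Equiv.prodAssoc _ _ _).trans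
      (Equiv.prodCongr (Equiv.refl _) Equiv.ulift.symm))
  rw [this]
  refine (Cardinal.mul_le_max _ _).trans (max_le (max_le (le_max_right _ _) ?_) (le_max_left _ _))
  exact le_max_of_le_left Cardinal.mk_le_aleph0

theorem countable_of_isWellOrderedChain_signCover (hKc : IsCompact K) (hK : Convex ℝ K)
    {C : Set (Clopens (signCover K))} (hC : IsWellOrderedChain C) : C.Countable := by
  classical
  have := isCompact_iff_compactSpace.1 (isCompact_signCover hKc)
  let _ : LinearOrder C := hC.1.linearOrder
  have hwf : WellFoundedLT C := by
    refine ⟨WellFounded.wellFounded_iff_has_min.2 fun S hS => ?_⟩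
    obtain ⟨a, ⟨a', ha', rfl⟩, hmin⟩ := hC.2 (Subtype.val '' S) (Subtype.coe_image_subset C S)
      (hS.image _)
    exact ⟨a', ha', fun x hx hlt => hlt.not_ge (hmin (mem_image_of_mem _ hx))⟩
  have hfin := fun A : C => exists_finset_forall_mem_of_isClopen
    (isClosedEmbedding_signCover_snd hKc).isInducing A.1.isClopen
  choose F hF using hfin
  have hchain : IsSignChain K rationalShift F
      fun A => {b | ∃ z ∈ A.1, ∀ t ∈ F A, b t = z.1.2 t} := by
    refine ⟨?_, ?_, ?_⟩
    · rintro A b b' hbb' ⟨z, hz, hbz⟩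
      exact ⟨z, hz, fun t ht => (hbb' t ht).symm.trans (hbz t ht)⟩
    · rintro A A' hAA' f hf b hb ⟨z, hz, hbz⟩
      have hmem : (⟨(f, b), hf, hb⟩ : signCover K) ∈ A.1 := hF A z hz _ hbz
      exact ⟨⟨(f, b), hf, hb⟩, hAA'.le hmem, fun _ _ => rfl⟩
    · intro A A' hAA'
      obtain ⟨z, hz', hz⟩ := not_subset.1
        (show ¬ ((A'.1 : Set (signCover K)) ⊆ A.1) from hAA'.not_ge)
      refine ⟨z.1.1, z.2.1, z.1.2, z.2.2, ⟨z, hz', fun _ _ => rfl⟩, ?_⟩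
      rintro ⟨w, hw, hzw⟩
      exact hz (hF A w hw z hzw)
  exact (hchain.countable hKc hK continuous_rationalShift).to_set

end SignCover

/-! ### The dual ball -/

theorem isCompact_weakStarDualBall (𝕜 : Type) (X : Type u) [RCLike 𝕜] [NormedAddCommGroup X]
    [NormedSpace 𝕜 X] : IsCompact (weakStarDualBall 𝕜 X) := by
  convert WeakDual.isCompact_closedBall (𝕜 := 𝕜) (E := X) 0 1
  ext f
  simp [weakStarDualBall]

theorem convex_range_re_weakStarDualBall {𝕜 : Type} {X : Type u} [RCLike 𝕜] [NormedAddCommGroup X]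
    [NormedSpace 𝕜 X] {I : Type*} (ξ : I → X) :
    Convex ℝ (range fun (f : weakStarDualBall 𝕜 X) i => RCLike.re (f.1 (ξ i))) := by
  rintro _ ⟨⟨f, hf⟩, rfl⟩ _ ⟨⟨f', hf'⟩, rfl⟩ a b ha hb hab
  refine ⟨⟨(a : 𝕜) • f + (b : 𝕜) • f', ?_⟩, ?_⟩
  · change ‖(a : 𝕜) • WeakDual.toStrongDual f + (b : 𝕜) • WeakDual.toStrongDual f'‖ ≤ 1
    change ‖WeakDual.toStrongDual f‖ ≤ 1 at hf
    change ‖WeakDual.toStrongDual f'‖ ≤ 1 at hf'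
    refine (norm_add_le _ _).trans ?_
    rw [norm_smul, norm_smul, RCLike.norm_of_nonneg ha, RCLike.norm_of_nonneg hb]
    nlinarith
  · ext i
    change RCLike.re ((a : 𝕜) * f (ξ i) + (b : 𝕜) * f' (ξ i)) = _
    simp

theorem mainTheorem3 (𝕜 : Type) [RCLike 𝕜] (X : Type u) [NormedAddCommGroup X]
    [NormedSpace 𝕜 X] [CompleteSpace X] :
    ∃ (L : Type u) (_ : TopologicalSpace L),
      CompactSpace L ∧ T2Space L ∧ TotallyDisconnectedSpace L ∧
      (∃ p : L → weakStarDualBall 𝕜 X, Continuous p ∧ Function.Surjective p) ∧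
      topologicalWeight L = topologicalWeight (weakStarDualBall 𝕜 X) ∧
      ∀ C : Set (Clopens L), IsWellOrderedChain C → C.Countable := by
  have hcomp := isCompact_iff_compactSpace.1 (isCompact_weakStarDualBall 𝕜 X)
  rcases subsingleton_or_nontrivial (weakStarDualBall 𝕜 X) with hZ | hZ
  · refine ⟨weakStarDualBall 𝕜 X, inferInstance, hcomp, inferInstance, inferInstance,
      ⟨id, continuous_id, Function.surjective_id⟩, rfl, fun C _ => ?_⟩
    have : Finite (Clopens (weakStarDualBall 𝕜 X)) :=
      Finite.of_injective (fun A => (A : Set (weakStarDualBall 𝕜 X))) SetLike.coe_injective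
    exact C.to_countable
  obtain ⟨B, hB, hBw⟩ := exists_isTopologicalBasis_mk_eq_topologicalWeight (weakStarDualBall 𝕜 X)
  have hcont : ∀ x : X, Continuous fun f : weakStarDualBall 𝕜 X => RCLike.re (f.1 x) := fun x =>
    RCLike.continuous_re.comp ((WeakDual.eval_continuous x).comp continuous_subtype_val)
  obtain ⟨ξ, hξ⟩ := exists_separating_of_isTopologicalBasis hB hcont fun f f' hff' => by
    by_contra! h
    refine hff' (Subtype.ext (DFunLike.ext _ _ fun x => RCLike.ext (h x) ?_))
    -- the imaginary part is recovered from the real parts, as `Im (f x) = - Re (f (I • x))`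
    have := h ((RCLike.I : 𝕜) • x)
    simpa using this
  set Φ : weakStarDualBall 𝕜 X → B × B → ℝ := fun f i => RCLike.re (f.1 (ξ i)) with hΦ
  have hΦc : Continuous Φ := continuous_pi fun i => hcont (ξ i)
  have hΦi : Function.Injective Φ := fun f f' hff' => by
    by_contra hne
    obtain ⟨i, hi⟩ := hξ f f' hne
    exact hi (congrFun hff' i)
  have hKc : IsCompact (range Φ) := isCompact_range hΦc
  have hK : Convex ℝ (range Φ) := convex_range_re_weakStarDualBall ξ
  have e := (hΦc.isClosedEmbedding hΦi).isEmbedding.toHomeomorph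
  have hinf : Infinite (weakStarDualBall 𝕜 X) := by
    have : (range Φ).Infinite := hK.isPreconnected.infinite_of_nontrivial (by
      obtain ⟨f, f', hff'⟩ := exists_pair_ne (weakStarDualBall 𝕜 X)
      exact ⟨_, ⟨f, rfl⟩, _, ⟨f', rfl⟩, hΦi.ne hff'⟩)
    have := this.to_subtype
    exact Infinite.of_injective e.symm e.symm.injective
  have hinfB := aleph0_le_topologicalWeight (weakStarDualBall 𝕜 X)
  have hcompL := isCompact_iff_compactSpace.1 (isCompact_signCover hKc)
  have hp : Continuous (e.symm ∘ fun z : signCover (range Φ) => (⟨z.1.1, z.2.1⟩ : range Φ)) :=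
    e.symm.continuous.comp ((continuous_fst.comp continuous_subtype_val).subtype_mk _)
  have hps : Function.Surjective
      (e.symm ∘ fun z : signCover (range Φ) => (⟨z.1.1, z.2.1⟩ : range Φ)) :=
    e.symm.surjective.comp surjective_signCover_fst
  refine ⟨signCover (range Φ), inferInstance, hcompL, inferInstance,
    totallyDisconnectedSpace_signCover, ⟨_, hp, hps⟩, le_antisymm ?_ ?_,
    fun C hC => countable_of_isWellOrderedChain_signCover hKc hK hC⟩
  · refine (topologicalWeight_signCover_le hKc).trans (max_le hinfB ?_)
    rw [← Cardinal.mul_def, hBw, Cardinal.mul_eq_self hinfB]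
  · have := Infinite.of_surjective _ hps
    exact (topologicalWeight_le_of_surjective hp hps).trans
      (max_le (aleph0_le_topologicalWeight _) le_rfl)
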